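/- All logarithms are to base $2$. For a graph $H$ and an integer $t \ge 0$, the blowup $H[t]$ is the graph obtained from $H$ by replacing every vertex by an independent set of order $t$ and every edge by a complete bipartite graph between the two corresponding independent sets. For a graph $H$ on $h$ vertices and $\gamma>0$, let $c_H(\gamma)\in[0,\infty]$ be the supremum of all real $c>0$ for which there is a function $\varepsilon(N)\to 0$ as $N\to\infty$ (depending only on $H,\gamma,c$) such that every $N$-vertex graph containing at least $\gamma N^h$ copies of $H$ (that is, subgraphs isomorphic to $H$) contains $H[t]$ as a (not necessarily induced) subgraph for some integer $t\ge (c-\varepsilon(N))\log N$ (with the convention $\log 0 = 0$ when $N = 0$). Theorem 5.2. For the triangle $K_3$ we have $$c_{K_3}(\gamma)=\Omega\left(\frac{\sqrt\gamma}{(\log\frac1\gamma)^2}\right),$$ that is, there is an absolute constant $\delta>0$ such that $c_{K_3}(\gamma)\ge \delta\sqrt{\gamma}/(\log\frac1\gamma)^2$ for all $0<\gamma<1$. (For $\gamma\ge\frac16$ no graph with $N\ge1$ vertices has $\gamma N^3$ triangles, and $c_{K_3}(\gamma)=\infty$.) -/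

import Mathlib

open Filter Topology
open scoped ENNReal

noncomputable section

/-- The `t`-blowup `H[t]`: every vertex of `H` is replaced by an independent set of `t` vertices
and every edge of `H` by a complete bipartite graph between the two corresponding sets. -/
def graphBlowup {W : Type*} (H : SimpleGraph W) (t : ℕ) : SimpleGraph (W × Fin t) where
  Adj x y := H.Adj x.1 y.1
  symm := ⟨fun _ _ h => H.adj_symm h⟩
  loopless := ⟨fun x h => H.loopless.irrefl x.1 h⟩

/-- `c` is admissible for `H` and `γ`: there is an error term `ε N → 0`, depending on `N` only,
such that every `N`-vertex graph with at least `γ * N ^ h` (unlabelled) copies of `H`, where `h` is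
the number of vertices of `H`, contains a blowup `H[t]` with `t ≥ (c - ε N) * log₂ N`, as a (not
necessarily induced) subgraph. -/
def IsBlowupConstant {W : Type*} [Fintype W] (H : SimpleGraph W) (γ c : ℝ) : Prop :=
  ∃ ε : ℕ → ℝ, Tendsto ε atTop (𝓝 0) ∧
    ∀ (N : ℕ) (G : SimpleGraph (Fin N)),
      γ * (N : ℝ) ^ Fintype.card W ≤ (G.copyCount H : ℝ) →
        ∃ t : ℕ, (c - ε N) * Real.logb 2 (N : ℝ) ≤ (t : ℝ) ∧
          (graphBlowup H t).IsContained G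

/-- The optimal constant `c_H(γ)` in Nikiforov's theorem: the supremum of all admissible `c > 0`.
It takes values in `[0, ∞]`, and is `∞` when arbitrarily large `c` are admissible. -/
def nikiforovConstant {W : Type*} [Fintype W] (H : SimpleGraph W) (γ : ℝ) : ℝ≥0∞ :=
  sSup (ENNReal.ofReal '' {c : ℝ | 0 < c ∧ IsBlowupConstant H γ c})

end

/-! Regularity reduces the problem to a triple of large classes whose three pairs are uniform and
whose triangle density is at least `γ / 2` (`exists_uniform_triple`). Two pairs sharing a class
cannot both have density below `√γ / 2`, since uniformity would then make triangles too rare. So two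
of the three pairs have density at least `√γ / 2`; call their common class `C`. The third pair `A`,
`B` still has density at least `γ / 2`.

Most edges between `A` and `B` are typical: their ends have about the expected degree into `C`, and
at least about the expected codegree. Kővári–Sós–Turán (`exists_complete_of_dense`), applied to
typical edges only, gives completely joined `m`-sets `A'`, `B'` with `m` of order `log N / log (1 /
γ)`. Let `y`, `z` be the densities of the pairs at `C`. The degrees of the vertices `c` of `C` into
`A'` and `B'` have products summing to about `m² y z |C|` or more, while the degrees themselves sum
to at most about `m (y + z) |C|`. As `y z` is at least `√γ / 4 * (y + z)`, a positive proportion of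
`C` has at least `√γ / 10 * m` neighbours in both sets (`le_card_popular`).

These vertices leave at most `4 ^ m` pairs of traces on `A'` and `B'`, far fewer than `|C|`. Many of
them therefore share the same traces, and these vertices with the two common traces span the blowup
(`graphBlowup_isContained_of_traces`). Its order is about `√γ log N / log (1 / γ)`, one logarithm
better than required. -/

namespace SimpleGraph

/-! ### Blowups of the triangle from complete triples and from repeated traces. -/

section Blowup

variable {V : Type*} {G : SimpleGraph V}

/-- Three pairwise completely joined vertex sets of size at least `t` contain `K₃[t]`. -/
lemma graphBlowup_isContained_of_complete [DecidableEq V] {X Y Z : Finset V} {t : ℕ}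
    (hX : t ≤ X.card) (hY : t ≤ Y.card) (hZ : t ≤ Z.card)
    (hXY : ∀ a ∈ X, ∀ b ∈ Y, G.Adj a b) (hXZ : ∀ a ∈ X, ∀ c ∈ Z, G.Adj a c)
    (hYZ : ∀ b ∈ Y, ∀ c ∈ Z, G.Adj b c) :
    (graphBlowup (⊤ : SimpleGraph (Fin 3)) t).IsContained G := by
  have key : ∀ S : Finset V, t ≤ S.card → ∃ f : Fin t → V, Function.Injective f ∧ ∀ j, f j ∈ S := by
    intro S hS
    obtain ⟨f⟩ : Nonempty (Fin t ↪ S) :=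
      Function.Embedding.nonempty_of_card_le (by simpa using hS)
    exact ⟨fun j => f j, fun i j h => f.injective (Subtype.ext h), fun j => (f j).2⟩
  obtain ⟨f, hf, hfX⟩ := key X hX
  obtain ⟨g, hg, hgY⟩ := key Y hY
  obtain ⟨h, hh, hhZ⟩ := key Z hZ
  let F : Fin 3 × Fin t → V := fun p => (![f, g, h] p.1) p.2
  have hadj : ∀ p q : Fin 3 × Fin t, p.1 ≠ q.1 → G.Adj (F p) (F q) := by
    rintro ⟨i, j⟩ ⟨i', j'⟩ hne
    fin_cases i <;> fin_cases i' <;> simp [F] at hne ⊢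
    · exact hXY _ (hfX _) _ (hgY _)
    · exact hXZ _ (hfX _) _ (hhZ _)
    · exact (hXY _ (hfX _) _ (hgY _)).symm
    · exact hYZ _ (hgY _) _ (hhZ _)
    · exact (hXZ _ (hfX _) _ (hhZ _)).symm
    · exact (hYZ _ (hgY _) _ (hhZ _)).symm
  refine ⟨⟨⟨F, fun {p q} hpq => hadj p q (by simpa [graphBlowup] using hpq)⟩, ?_⟩⟩
  rintro ⟨i, j⟩ ⟨i', j'⟩ hpq
  change F (i, j) = F (i', j') at hpq
  obtain rfl | hne := eq_or_ne i i'
  · fin_cases i <;> simp [F] at hpq ⊢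
    · exact hf hpq
    · exact hg hpq
    · exact hh hpq
  · exact absurd hpq (hadj (i, j) (i', j') hne).ne

/-- If `A` and `B` are completely joined `m`-sets and many vertices have at least `t` neighbours
in each of them, then two vertex traces coincide often enough to produce `K₃[t]`. -/
lemma graphBlowup_isContained_of_traces [DecidableEq V] [DecidableRel G.Adj]
    {A B C : Finset V} {m t : ℕ} (hA : A.card = m) (hB : B.card = m)
    (hAB : ∀ a ∈ A, ∀ b ∈ B, G.Adj a b) (hC : 4 ^ m * t ≤ C.card)
    (hCA : ∀ c ∈ C, t ≤ (A.filter (G.Adj c)).card) (hCB : ∀ c ∈ C, t ≤ (B.filter (G.Adj c)).card) :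
    (graphBlowup (⊤ : SimpleGraph (Fin 3)) t).IsContained G := by
  -- There are `2 ^ m * 2 ^ m` possible pairs of traces, so the pigeonhole principle finds one
  -- shared by `t` vertices.
  have hcard : (A.powerset ×ˢ B.powerset).card * t ≤ C.card := by
    rw [Finset.card_product, Finset.card_powerset, Finset.card_powerset, hA, hB, ← mul_pow]
    exact hC
  obtain ⟨⟨X, Y⟩, -, hfib⟩ := Finset.exists_le_card_fiber_of_mul_le_card_of_maps_to
    (s := C) (t := A.powerset ×ˢ B.powerset)
    (f := fun c => (A.filter (G.Adj c), B.filter (G.Adj c)))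
    (fun c _ => by simp [Finset.filter_subset]) ⟨(∅, ∅), by simp⟩ hcard
  -- For `t = 0` the fibre may be empty, and then no vertex realises `X` and `Y` as its traces.
  obtain rfl | ht := Nat.eq_zero_or_pos t
  · exact graphBlowup_isContained_of_complete (X := ∅) (Y := ∅) (Z := ∅) (by simp) (by simp)
      (by simp) (by simp) (by simp) (by simp)
  set Z := C.filter (fun c => (A.filter (G.Adj c), B.filter (G.Adj c)) = (X, Y)) with hZ
  have hmem : ∀ c ∈ Z, c ∈ C ∧ A.filter (G.Adj c) = X ∧ B.filter (G.Adj c) = Y := by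
    intro c hc
    simpa [hZ] using hc
  obtain ⟨c, hc⟩ : Z.Nonempty := Finset.card_pos.1 (ht.trans_le hfib)
  have hXA : X ⊆ A := by rw [← (hmem c hc).2.1]; exact Finset.filter_subset _ _
  have hYB : Y ⊆ B := by rw [← (hmem c hc).2.2]; exact Finset.filter_subset _ _
  refine graphBlowup_isContained_of_complete (X := X) (Y := Y) (Z := Z) ?_ ?_ hfib
    (fun a ha b hb => hAB a (hXA ha) b (hYB hb)) ?_ ?_
  · rw [← (hmem c hc).2.1]; exact hCA c (hmem c hc).1
  · rw [← (hmem c hc).2.2]; exact hCB c (hmem c hc).1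
  · intro a ha c hc
    rw [← (hmem c hc).2.1] at ha
    exact (Finset.mem_filter.1 ha).2.symm
  · intro a ha c hc
    rw [← (hmem c hc).2.2] at ha
    exact (Finset.mem_filter.1 ha).2.symm

end Blowup

end SimpleGraph

/-! ### Complete bipartite pairs in dense relations. -/

/-- Kővári–Sós–Turán for a relation of density at least `ρ`. -/
lemma exists_complete_of_dense {α β : Type*} [DecidableEq α] [DecidableEq β]
    (r : α → β → Prop) [∀ a b, Decidable (r a b)] {A : Finset α} {B : Finset β} {m : ℕ} {ρ : ℝ}
    (hρ : 0 < ρ) (hr : ρ * A.card * B.card ≤ ∑ b ∈ B, ((A.filter (r · b)).card : ℝ))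
    (hm : (m : ℝ) ≤ ρ / 4 * A.card) (hA : 0 < A.card) (hB : 0 < B.card)
    (hmB : (m : ℝ) ≤ ρ / 2 * (ρ / 4) ^ m * B.card) :
    ∃ A' ⊆ A, ∃ B' ⊆ B, A'.card = m ∧ B'.card = m ∧ ∀ a ∈ A', ∀ b ∈ B', r a b := by
  have hAR : (0 : ℝ) < A.card := by exact_mod_cast hA
  have hBR : (0 : ℝ) < B.card := by exact_mod_cast hB
  -- Vertices of at least half the average degree. The others account for at most half of the
  -- density, so `D` is at least a `ρ / 2` fraction of `B`.
  set D := B.filter (fun b => ρ / 2 * A.card ≤ ((A.filter (r · b)).card : ℝ)) with hD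
  have hDcard : ρ / 2 * B.card ≤ D.card := by
    have h1 : ∑ b ∈ B, ((A.filter (r · b)).card : ℝ) ≤ D.card * A.card + B.card * (ρ / 2 * A.card) := by
      rw [← Finset.sum_filter_add_sum_filter_not B
        (fun b => ρ / 2 * A.card ≤ ((A.filter (r · b)).card : ℝ))]
      refine add_le_add ?_ ?_
      · rw [← nsmul_eq_mul]
        exact Finset.sum_le_card_nsmul _ _ _ fun b _ => by
          exact_mod_cast Finset.card_filter_le _ _
      · calc _ ≤ ((B.filter (fun b => ¬ ρ / 2 * A.card ≤ ((A.filter (r · b)).card : ℝ))).card : ℝ)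
              * (ρ / 2 * A.card) := by
              rw [← nsmul_eq_mul]
              exact Finset.sum_le_card_nsmul _ _ _ fun b hb => by
                simp only [Finset.mem_filter, not_le] at hb; exact hb.2.le
          _ ≤ _ := by
              gcongr
              exact Finset.filter_subset _ _
    have h2 : ρ / 2 * B.card * A.card ≤ D.card * A.card := by nlinarith
    exact le_of_mul_le_mul_right h2 hAR
  -- A degree `d ≥ ρ / 2 * |A|` stays above `ρ / 4 * |A|` after losing `m`, so each factor of the
  -- falling factorial of `d` is at least `ρ / 4 * |A|`.
  have hchoose : ∀ b ∈ D, (ρ / 4) ^ m * (A.card.choose m : ℝ) ≤ ((A.filter (r · b)).card.choose m : ℝ) := by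
    intro b hb
    have hb' := (Finset.mem_filter.1 hb).2
    set d := (A.filter (r · b)).card
    have hmd : ρ / 4 * A.card ≤ ((d + 1 - m : ℕ) : ℝ) := by
      have : (d : ℝ) - m ≤ ((d + 1 - m : ℕ) : ℝ) := by
        have h : d ≤ (d + 1 - m) + m := by omega
        have : (d : ℝ) ≤ ((d + 1 - m : ℕ) : ℝ) + m := by exact_mod_cast h
        linarith
      linarith
    have h1 : ((d + 1 - m : ℕ) : ℝ) ^ m ≤ (m.factorial : ℝ) * d.choose m := by
      have := Nat.pow_sub_le_descFactorial d m
      rw [Nat.descFactorial_eq_factorial_mul_choose] at this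
      exact_mod_cast this
    have h2 : (m.factorial : ℝ) * A.card.choose m ≤ (A.card : ℝ) ^ m := by
      have := Nat.descFactorial_le_pow A.card m
      rw [Nat.descFactorial_eq_factorial_mul_choose] at this
      exact_mod_cast this
    have hfac : (0 : ℝ) < m.factorial := by exact_mod_cast m.factorial_pos
    refine le_of_mul_le_mul_left ?_ hfac
    calc (m.factorial : ℝ) * ((ρ / 4) ^ m * A.card.choose m)
        = (ρ / 4) ^ m * (m.factorial * A.card.choose m) := by ring
      _ ≤ (ρ / 4) ^ m * (A.card : ℝ) ^ m := by gcongr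
      _ = (ρ / 4 * A.card) ^ m := by rw [mul_pow]
      _ ≤ ((d + 1 - m : ℕ) : ℝ) ^ m := by gcongr
      _ ≤ _ := h1
  have hdouble : ∑ S ∈ A.powersetCard m, ((D.filter (fun b => ∀ a ∈ S, r a b)).card : ℝ)
      = ∑ b ∈ D, ((A.filter (r · b)).card.choose m : ℝ) := by
    have h := Finset.sum_card_bipartiteAbove_eq_sum_card_bipartiteBelow
      (s := A.powersetCard m) (t := D) (fun S b => ∀ a ∈ S, r a b)
    have h' : ∀ b, ((A.powersetCard m).bipartiteBelow (fun S b => ∀ a ∈ S, r a b) b).card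
        = (A.filter (r · b)).card.choose m := by
      intro b
      rw [← Finset.card_powersetCard]
      congr 1
      ext S
      simp only [Finset.bipartiteBelow, Finset.mem_filter, Finset.mem_powersetCard,
        Finset.subset_iff]
      grind
    simp only [h'] at h
    exact_mod_cast h
  have hAm : m ≤ A.card := by
    have : ρ / 4 ≤ 1 := by
      have h1 : ∑ b ∈ B, ((A.filter (r · b)).card : ℝ) ≤ B.card * A.card := by
        rw [← nsmul_eq_mul]
        exact Finset.sum_le_card_nsmul _ _ _ fun b _ => by
          exact_mod_cast Finset.card_filter_le _ _
      have h2 : ρ * (A.card * B.card) ≤ 1 * (A.card * B.card) := by nlinarith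
      have := le_of_mul_le_mul_right h2 (by positivity)
      linarith
    have : (m : ℝ) ≤ A.card := hm.trans (mul_le_of_le_one_left hAR.le this)
    exact_mod_cast this
  -- Some `m`-set has at least the average number of common neighbours in `D`.
  obtain ⟨S, hS, hSle⟩ : ∃ S ∈ A.powersetCard m,
      ρ / 2 * (ρ / 4) ^ m * B.card ≤ ((D.filter (fun b => ∀ a ∈ S, r a b)).card : ℝ) := by
    refine Finset.exists_le_of_sum_le (Finset.powersetCard_nonempty.2 hAm) ?_
    rw [hdouble, Finset.sum_const, Finset.card_powersetCard, nsmul_eq_mul]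
    calc (A.card.choose m : ℝ) * (ρ / 2 * (ρ / 4) ^ m * B.card)
        = (ρ / 2 * B.card) * ((ρ / 4) ^ m * A.card.choose m) := by ring
      _ ≤ D.card * ((ρ / 4) ^ m * A.card.choose m) := by gcongr
      _ ≤ _ := by
        rw [← nsmul_eq_mul]
        exact Finset.card_nsmul_le_sum _ _ _ hchoose
  obtain ⟨B', hB', hB'card⟩ := Finset.exists_subset_card_eq
    (show m ≤ (D.filter (fun b => ∀ a ∈ S, r a b)).card by exact_mod_cast hmB.trans hSle)
  rw [Finset.mem_powersetCard] at hS
  refine ⟨S, hS.1, B', fun b hb => ?_, hS.2, hB'card, fun a ha b hb => ?_⟩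
  · exact (Finset.mem_filter.1 (Finset.mem_filter.1 (hB' hb)).1).1
  · exact (Finset.mem_filter.1 (hB' hb)).2 a ha

lemma Finset.card_filter_product_eq_sum {α β : Type*} (r : α → β → Prop)
    [∀ a b, Decidable (r a b)] (A : Finset α) (B : Finset β) :
    (((A ×ˢ B).filter fun p => r p.1 p.2).card : ℝ) = ∑ b ∈ B, ((A.filter (r · b)).card : ℝ) := by
  rw [Finset.card_filter, Finset.sum_product_right]
  push_cast
  exact Finset.sum_congr rfl fun b _ => by rw [Finset.card_filter]; push_cast; rfl

namespace SimpleGraph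

/-! ### Degrees, codegrees and triangle counts in uniform pairs. -/

section Uniform

variable {V : Type*} {G : SimpleGraph V} [DecidableRel G.Adj]

lemma card_interedges_eq_sum (S T : Finset V) :
    ((G.interedges S T).card : ℝ) = ∑ a ∈ S, ((T.filter (G.Adj a)).card : ℝ) := by
  rw [interedges_def, Finset.card_filter, Finset.sum_product]
  push_cast
  exact Finset.sum_congr rfl fun a _ => by rw [Finset.card_filter]; push_cast; rfl

lemma sum_card_filter_adj_eq (S T : Finset V) :
    ∑ a ∈ S, ((T.filter (G.Adj a)).card : ℝ) = G.edgeDensity S T * S.card * T.card := by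
  rw [← card_interedges_eq_sum, edgeDensity_def]
  push_cast
  rcases Finset.eq_empty_or_nonempty S with rfl | hS
  · simp
  rcases Finset.eq_empty_or_nonempty T with rfl | hT
  · simp [interedges_def]
  have : (S.card : ℝ) ≠ 0 := by exact_mod_cast hS.card_pos.ne'
  have : (T.card : ℝ) ≠ 0 := by exact_mod_cast hT.card_pos.ne'
  field_simp

/-- In a uniform pair few vertices have low degree into a large subset of the other side. -/
lemma IsUniform.card_low_degree_le {η : ℝ} {S T T' : Finset V} (h : G.IsUniform η S T)
    (hT' : T' ⊆ T) (hcard : T.card * η ≤ T'.card) (hpos : 0 < T'.card) :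
    ((S.filter fun a => ((T'.filter (G.Adj a)).card : ℝ) < (G.edgeDensity S T - η) * T'.card).card
      : ℝ) ≤ S.card * η := by
  by_contra! hlt
  set X := S.filter fun a => ((T'.filter (G.Adj a)).card : ℝ) < (G.edgeDensity S T - η) * T'.card
  -- If there were too many exceptional vertices, their set together with `T'` would itself violate
  -- uniformity.
  have hu := h (Finset.filter_subset _ S) hT' hlt.le hcard
  have hX : (0 : ℝ) < X.card := lt_of_le_of_lt (by have := h.pos; positivity) hlt
  have hT : (0 : ℝ) < T'.card := by exact_mod_cast hpos
  have hsum : ∑ a ∈ X, ((T'.filter (G.Adj a)).card : ℝ)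
      ≤ X.card * ((G.edgeDensity S T - η) * T'.card) := by
    rw [← nsmul_eq_mul]
    exact Finset.sum_le_card_nsmul _ _ _ fun a ha => (Finset.mem_filter.1 ha).2.le
  rw [sum_card_filter_adj_eq] at hsum
  have : (G.edgeDensity X T' : ℝ) * (X.card * T'.card)
      ≤ (G.edgeDensity S T - η) * (X.card * T'.card) := by linarith
  have := le_of_mul_le_mul_right this (by positivity)
  rw [abs_lt] at hu
  linarith [hu.1]

/-- In a uniform pair few vertices have high degree into the other side. -/
lemma IsUniform.card_high_degree_le {η : ℝ} {S T : Finset V} (h : G.IsUniform η S T)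
    (hη : η ≤ 1) (hpos : 0 < T.card) :
    ((S.filter fun a => (G.edgeDensity S T + η) * T.card < ((T.filter (G.Adj a)).card : ℝ)).card
      : ℝ) ≤ S.card * η := by
  by_contra! hlt
  set X := S.filter fun a => (G.edgeDensity S T + η) * T.card < ((T.filter (G.Adj a)).card : ℝ)
  have hu := h (Finset.filter_subset _ S) subset_rfl hlt.le
    (mul_le_of_le_one_right (by positivity) hη)
  have hX : (0 : ℝ) < X.card := lt_of_le_of_lt (by have := h.pos; positivity) hlt
  have hT : (0 : ℝ) < T.card := by exact_mod_cast hpos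
  have hsum : X.card * ((G.edgeDensity S T + η) * T.card)
      ≤ ∑ a ∈ X, ((T.filter (G.Adj a)).card : ℝ) := by
    rw [← nsmul_eq_mul]
    exact Finset.card_nsmul_le_sum _ _ _ fun a ha => (Finset.mem_filter.1 ha).2.le
  rw [sum_card_filter_adj_eq] at hsum
  have : (G.edgeDensity S T + η) * (X.card * T.card)
      ≤ (G.edgeDensity X T : ℝ) * (X.card * T.card) := by linarith
  have := le_of_mul_le_mul_right this (by positivity)
  rw [abs_lt] at hu
  linarith [hu.2]

variable (G) in
/-- The number of ordered triangles with vertices in `A`, `B` and `C`, respectively. -/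
noncomputable def triangleCount (A B C : Finset V) : ℝ :=
  ∑ a ∈ A, ∑ b ∈ B, ∑ c ∈ C, if G.Adj a b ∧ G.Adj a c ∧ G.Adj b c then 1 else 0

lemma triangleCount_swap_right (A B C : Finset V) :
    G.triangleCount A B C = G.triangleCount A C B := by
  unfold triangleCount
  refine Finset.sum_congr rfl fun a _ => ?_
  rw [Finset.sum_comm]
  refine Finset.sum_congr rfl fun c _ => Finset.sum_congr rfl fun b _ => ?_
  simp only [G.adj_comm c b]
  congr 1
  simp only [eq_iff_iff]
  tauto

lemma triangleCount_swap_left (A B C : Finset V) :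
    G.triangleCount A B C = G.triangleCount B A C := by
  unfold triangleCount
  rw [Finset.sum_comm]
  refine Finset.sum_congr rfl fun b _ => Finset.sum_congr rfl fun a _ =>
    Finset.sum_congr rfl fun c _ => ?_
  simp only [G.adj_comm b a]
  congr 1
  simp only [eq_iff_iff]
  tauto

lemma triangleCount_le_edgeDensity (A B C : Finset V) :
    G.triangleCount A B C ≤ G.edgeDensity A B * A.card * B.card * C.card := by
  rw [← sum_card_filter_adj_eq, Finset.sum_mul]
  refine Finset.sum_le_sum fun a _ => ?_
  rw [Finset.card_filter]
  push_cast
  rw [Finset.sum_mul]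
  refine Finset.sum_le_sum fun b _ => ?_
  by_cases h : G.Adj a b
  · simp only [h, true_and, if_true, one_mul]
    calc _ ≤ ∑ c ∈ C, (1 : ℝ) := Finset.sum_le_sum fun c _ => by split_ifs <;> norm_num
      _ = _ := by simp
  · simp [h]

/-- The number of triangles is controlled by the densities of a uniform pair and of another pair. -/
lemma IsUniform.triangleCount_le {η : ℝ} {A B : Finset V} (h : G.IsUniform η A B) (hη : η ≤ 1)
    (C : Finset V) :
    G.triangleCount A B C ≤ ((G.edgeDensity A B + η) * G.edgeDensity A C + η)
      * (A.card * B.card * C.card) := by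
  have hη0 := h.pos
  have hcount : G.triangleCount A B C
      ≤ ∑ c ∈ C, ∑ a ∈ A.filter (G.Adj c), ((B.filter (G.Adj a)).card : ℝ) := by
    rw [triangleCount_swap_right, triangleCount, Finset.sum_comm]
    refine Finset.sum_le_sum fun c _ => ?_
    rw [Finset.sum_filter]
    refine Finset.sum_le_sum fun a _ => ?_
    by_cases hac : G.Adj a c
    · simp only [hac, true_and, hac.symm, if_true, Finset.card_filter]
      push_cast
      refine Finset.sum_le_sum fun b _ => ?_
      split_ifs <;> simp_all
    · simp [hac]
      split_ifs <;> positivity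
  -- The adjacency of `b` and `c` has been dropped, so what remains is the number of edges from the
  -- neighbourhood of `c` in `A` to `B`. Uniformity bounds it if the neighbourhood is large;
  -- otherwise it is at most `η |A| |B|`.
  have hstep : ∀ c ∈ C, ∑ a ∈ A.filter (G.Adj c), ((B.filter (G.Adj a)).card : ℝ)
      ≤ (G.edgeDensity A B + η) * (A.filter (G.Adj c)).card * B.card + η * A.card * B.card := by
    intro c _
    rw [sum_card_filter_adj_eq]
    have hd0 : (0 : ℝ) ≤ G.edgeDensity A B := by exact_mod_cast G.edgeDensity_nonneg A B
    have hd1 : (G.edgeDensity (A.filter (G.Adj c)) B : ℝ) ≤ 1 := by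
      exact_mod_cast G.edgeDensity_le_one _ _
    rcases le_total (A.card * η) ((A.filter (G.Adj c)).card : ℝ) with hge | hlt
    · have hu := h (Finset.filter_subset (G.Adj c) A) subset_rfl hge
        (mul_le_of_le_one_right (by positivity) hη)
      rw [abs_lt] at hu
      have : (G.edgeDensity (A.filter (G.Adj c)) B : ℝ) ≤ G.edgeDensity A B + η := by linarith [hu.2]
      calc _ ≤ (G.edgeDensity A B + η) * (A.filter (G.Adj c)).card * B.card := by gcongr
        _ ≤ _ := le_add_of_nonneg_right (by positivity)
    · calc _ ≤ 1 * (A.card * η) * B.card := by gcongr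
        _ = η * A.card * B.card := by ring
        _ ≤ _ := le_add_of_nonneg_left (by positivity)
  refine (hcount.trans (Finset.sum_le_sum hstep)).trans_eq ?_
  rw [Finset.sum_add_distrib, ← Finset.sum_mul, ← Finset.mul_sum, sum_card_filter_adj_eq,
    G.edgeDensity_comm C A, Finset.sum_const, nsmul_eq_mul]
  ring

/-- A triple of vertex classes whose pairs are dense enough, with uniform pairs at `C`, contains
a dense set of edges between `A` and `B` with controlled degrees and codegrees to `C`. -/
lemma IsUniform.card_typical_edges {η x y z : ℝ} {A B C : Finset V} (hη : η ≤ 1)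
    (hAC : G.IsUniform η A C) (hBC : G.IsUniform η B C)
    (hx : G.edgeDensity A B = x) (hy : G.edgeDensity A C = y) (hz : G.edgeDensity B C = z)
    (hC : 0 < C.card) (hyη : 2 * η ≤ y) (hzη : η ≤ z) :
    (x - 4 * η) * A.card * B.card ≤ ∑ b ∈ B, ((A.filter fun a => G.Adj a b ∧
      ((C.filter (G.Adj a)).card : ℝ) ≤ (y + η) * C.card ∧
      ((C.filter (G.Adj b)).card : ℝ) ≤ (z + η) * C.card ∧
      (y - η) * (z - η) * C.card ≤ ((C.filter fun c => G.Adj a c ∧ G.Adj b c).card : ℝ)).card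
        : ℝ) := by
  classical
  have hη0 := hAC.pos
  have hCR : (0 : ℝ) < C.card := by exact_mod_cast hC
  set A₁ := A.filter fun a => (y + η) * C.card < ((C.filter (G.Adj a)).card : ℝ)
  set A₂ := A.filter fun a => ((C.filter (G.Adj a)).card : ℝ) < (y - η) * C.card
  set B₁ := B.filter fun b => (z + η) * C.card < ((C.filter (G.Adj b)).card : ℝ)
  have hA₁ : (A₁.card : ℝ) ≤ A.card * η := by
    simpa only [hy] using hAC.card_high_degree_le hη hC
  have hA₂ : (A₂.card : ℝ) ≤ A.card * η := by
    simpa only [hy] using hAC.card_low_degree_le subset_rfl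
      (mul_le_of_le_one_right (by positivity) hη) hC
  have hB₁ : (B₁.card : ℝ) ≤ B.card * η := by
    simpa only [hz] using hBC.card_high_degree_le hη hC
  set B₂ : V → Finset V := fun a => B.filter fun b =>
    (((C.filter (G.Adj a)).filter (G.Adj b)).card : ℝ) < (z - η) * (C.filter (G.Adj a)).card
  have hB₂ : ∀ a ∈ A, a ∉ A₂ → ((B₂ a).card : ℝ) ≤ B.card * η := by
    intro a ha ha₂
    have hdeg : (y - η) * C.card ≤ ((C.filter (G.Adj a)).card : ℝ) := by
      by_contra! hlt
      exact ha₂ (Finset.mem_filter.2 ⟨ha, hlt⟩)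
    -- From `2 * η ≤ y`, the neighbourhood of `a` is large enough to test the uniformity of `B`, `C`
    -- against it.
    have hle : C.card * η ≤ ((C.filter (G.Adj a)).card : ℝ) := by nlinarith
    have hpos : 0 < (C.filter (G.Adj a)).card := by
      have : (0 : ℝ) < (C.filter (G.Adj a)).card := lt_of_lt_of_le (by positivity) hle
      exact_mod_cast this
    simpa only [hz] using hBC.card_low_degree_le (Finset.filter_subset _ C) hle hpos
  set E := (A ×ˢ B).filter fun p => G.Adj p.1 p.2 ∧
      ((C.filter (G.Adj p.1)).card : ℝ) ≤ (y + η) * C.card ∧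
      ((C.filter (G.Adj p.2)).card : ℝ) ≤ (z + η) * C.card ∧
      (y - η) * (z - η) * C.card ≤ ((C.filter fun c => G.Adj p.1 c ∧ G.Adj p.2 c).card : ℝ)
  have hE := Finset.card_filter_product_eq_sum (fun a b => G.Adj a b ∧
      ((C.filter (G.Adj a)).card : ℝ) ≤ (y + η) * C.card ∧
      ((C.filter (G.Adj b)).card : ℝ) ≤ (z + η) * C.card ∧
      (y - η) * (z - η) * C.card ≤ ((C.filter fun c => G.Adj a c ∧ G.Adj b c).card : ℝ)) A B
  rw [← hE]
  set F := ((A \ A₂) ×ˢ B).filter fun p => p.2 ∈ B₂ p.1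
  have hF : (F.card : ℝ) ≤ A.card * (B.card * η) := by
    have h0 : F ⊆ (A \ A₂).biUnion fun a => (B₂ a).image fun b => (a, b) := by
      rintro ⟨a, b⟩ hab
      obtain ⟨h1, h2⟩ := Finset.mem_filter.1 hab
      exact Finset.mem_biUnion.2 ⟨a, (Finset.mem_product.1 h1).1, Finset.mem_image.2 ⟨b, h2, rfl⟩⟩
    have h1 : F.card ≤ ∑ a ∈ A \ A₂, (B₂ a).card :=
      (Finset.card_le_card h0).trans (Finset.card_biUnion_le.trans
        (Finset.sum_le_sum fun a _ => Finset.card_image_le))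
    have h2 : (F.card : ℝ) ≤ ∑ a ∈ A \ A₂, ((B₂ a).card : ℝ) := by exact_mod_cast h1
    refine h2.trans ?_
    calc ∑ a ∈ A \ A₂, ((B₂ a).card : ℝ) ≤ (A \ A₂).card * (B.card * η) := by
          rw [← nsmul_eq_mul]
          exact Finset.sum_le_card_nsmul _ _ _ fun a ha =>
            hB₂ a (Finset.mem_sdiff.1 ha).1 (Finset.mem_sdiff.1 ha).2
      _ ≤ _ := by
          gcongr
          exact Finset.sdiff_subset
  -- The four exceptional families each cost at most `η |A| |B|` edges, whence the `4 * η`.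
  have hcover : G.interedges A B ⊆ E ∪ (A₁ ×ˢ B ∪ (A₂ ×ˢ B ∪ (A ×ˢ B₁ ∪ F))) := by
    rintro ⟨a, b⟩ hab
    rw [mk_mem_interedges_iff] at hab
    obtain ⟨ha, hb, hadj⟩ := hab
    by_contra hno
    simp only [Finset.mem_union, Finset.mem_product, not_or, not_and] at hno
    obtain ⟨h0, h1, h2, h3, h4⟩ := hno
    have ha1 : ((C.filter (G.Adj a)).card : ℝ) ≤ (y + η) * C.card := by
      by_contra! hlt
      exact h1 (Finset.mem_filter.2 ⟨ha, hlt⟩) hb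
    have ha2 : a ∉ A₂ := fun h => h2 h hb
    have ha2' : (y - η) * C.card ≤ ((C.filter (G.Adj a)).card : ℝ) := by
      by_contra! hlt
      exact ha2 (Finset.mem_filter.2 ⟨ha, hlt⟩)
    have hb1 : ((C.filter (G.Adj b)).card : ℝ) ≤ (z + η) * C.card := by
      by_contra! hlt
      exact h3 ha (Finset.mem_filter.2 ⟨hb, hlt⟩)
    have hb2 : (z - η) * (C.filter (G.Adj a)).card
        ≤ (((C.filter (G.Adj a)).filter (G.Adj b)).card : ℝ) := by
      by_contra! hlt
      exact h4 (Finset.mem_filter.2 ⟨Finset.mem_product.2 ⟨Finset.mem_sdiff.2 ⟨ha, ha2⟩, hb⟩,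
        Finset.mem_filter.2 ⟨hb, hlt⟩⟩)
    refine h0 (Finset.mem_filter.2 ⟨Finset.mem_product.2 ⟨ha, hb⟩, hadj, ha1, hb1, ?_⟩)
    rw [Finset.filter_filter] at hb2
    refine le_trans ?_ hb2
    calc (y - η) * (z - η) * C.card = (z - η) * ((y - η) * C.card) := by ring
      _ ≤ _ := mul_le_mul_of_nonneg_left ha2' (by linarith)
  have hcard : ((G.interedges A B).card : ℝ)
      ≤ E.card + (A₁.card * B.card + (A₂.card * B.card + (A.card * B₁.card + F.card))) := by
    have h1 := (Finset.card_le_card hcover).trans ((Finset.card_union_le _ _).trans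
      (Nat.add_le_add_left ((Finset.card_union_le _ _).trans
      (Nat.add_le_add_left ((Finset.card_union_le _ _).trans
      (Nat.add_le_add_left (Finset.card_union_le _ _) _)) _)) _))
    simp only [Finset.card_product] at h1
    exact_mod_cast h1
  rw [card_interedges_eq_sum, sum_card_filter_adj_eq, hx] at hcard
  have e1 : (A₁.card : ℝ) * B.card ≤ A.card * η * B.card := by gcongr
  have e2 : (A₂.card : ℝ) * B.card ≤ A.card * η * B.card := by gcongr
  have e3 : (A.card : ℝ) * B₁.card ≤ A.card * (B.card * η) := by gcongr
  linarith

/-- If two `m`-sets have bounded degrees to `C` and large pairwise codegrees, then many vertices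
of `C` have at least `θ` neighbours in both sets. -/
lemma le_card_popular [DecidableEq V] {A B C : Finset V} {m : ℕ} {p q d θ : ℝ} (hθ : 0 ≤ θ)
    (hA : A.card = m) (hB : B.card = m)
    (hp : ∀ a ∈ A, ((C.filter (G.Adj a)).card : ℝ) ≤ p)
    (hq : ∀ b ∈ B, ((C.filter (G.Adj b)).card : ℝ) ≤ q)
    (hd : ∀ a ∈ A, ∀ b ∈ B, d ≤ ((C.filter fun c => G.Adj a c ∧ G.Adj b c).card : ℝ)) :
    m * m * d ≤ m * m * (C.filter fun c => θ ≤ ((A.filter (G.Adj c)).card : ℝ) ∧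
      θ ≤ ((B.filter (G.Adj c)).card : ℝ)).card + θ * (m * p + m * q) := by
  set dA : V → ℝ := fun c => ((A.filter (G.Adj c)).card : ℝ)
  set dB : V → ℝ := fun c => ((B.filter (G.Adj c)).card : ℝ)
  set C' := C.filter fun c => θ ≤ dA c ∧ θ ≤ dB c with hC'
  have hm0 : (0 : ℝ) ≤ m := by positivity
  have hswap : ∀ S T : Finset V, ∑ c ∈ S, ((T.filter (G.Adj c)).card : ℝ)
      = ∑ a ∈ T, ((S.filter (G.Adj a)).card : ℝ) := by
    intro S T
    rw [sum_card_filter_adj_eq, sum_card_filter_adj_eq, G.edgeDensity_comm T S]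
    ring
  have hsumA : ∑ c ∈ C, dA c ≤ m * p := by
    rw [hswap, ← hA, ← nsmul_eq_mul]
    refine Finset.sum_le_card_nsmul _ _ _ fun a ha => ?_
    exact hp a ha
  have hsumB : ∑ c ∈ C, dB c ≤ m * q := by
    rw [hswap, ← hB, ← nsmul_eq_mul]
    refine Finset.sum_le_card_nsmul _ _ _ fun b hb => ?_
    exact hq b hb
  have hsumAB : m * m * d ≤ ∑ c ∈ C, dA c * dB c := by
    have h1 : ∑ c ∈ C, dA c * dB c
        = ∑ a ∈ A, ∑ b ∈ B, ((C.filter fun c => G.Adj a c ∧ G.Adj b c).card : ℝ) := by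
      have h2 : ∀ c ∈ C, dA c * dB c
          = ∑ a ∈ A, ∑ b ∈ B, if G.Adj a c ∧ G.Adj b c then (1 : ℝ) else 0 := by
        intro c _
        simp only [dA, dB, Finset.card_filter, G.adj_comm c]
        push_cast
        rw [Finset.sum_mul_sum]
        refine Finset.sum_congr rfl fun a _ => Finset.sum_congr rfl fun b _ => ?_
        by_cases h : G.Adj a c <;> simp [h]
      rw [Finset.sum_congr rfl h2, Finset.sum_comm]
      refine Finset.sum_congr rfl fun a _ => ?_
      rw [Finset.sum_comm]
      refine Finset.sum_congr rfl fun b _ => ?_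
      rw [Finset.card_filter]
      push_cast
      rfl
    rw [h1]
    calc m * m * d
        = ∑ a ∈ A, ∑ b ∈ B, d := by
          simp only [Finset.sum_const, hA, hB, nsmul_eq_mul]
          ring
      _ ≤ _ := Finset.sum_le_sum fun a ha => Finset.sum_le_sum fun b hb =>
          hd a ha b hb
  have hdA : ∀ c, 0 ≤ dA c ∧ dA c ≤ m := fun c => ⟨by positivity, by
    rw [← hA]; exact Nat.cast_le.2 (Finset.card_filter_le _ _)⟩
  have hdB : ∀ c, 0 ≤ dB c ∧ dB c ≤ m := fun c => ⟨by positivity, by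
    rw [← hB]; exact Nat.cast_le.2 (Finset.card_filter_le _ _)⟩
  have hterm : ∀ c ∈ C, dA c * dB c ≤ (if c ∈ C' then (m : ℝ) * m else 0)
      + θ * (dA c + dB c) := by
    intro c hc
    obtain ⟨hA0, hAm⟩ := hdA c
    obtain ⟨hB0, hBm⟩ := hdB c
    split_ifs with h
    · exact (mul_le_mul hAm hBm hB0 hm0).trans (le_add_of_nonneg_right (by positivity))
    -- An unpopular vertex contributes to the sum of products at most `θ` times its other degree.
    · have h' : dA c < θ ∨ dB c < θ := by
        by_contra! hge
        exact h (Finset.mem_filter.2 ⟨hc, hge⟩)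
      rw [zero_add, mul_add]
      rcases h' with h' | h'
      · exact (mul_le_mul_of_nonneg_right h'.le hB0).trans
          (le_add_of_nonneg_left (mul_nonneg hθ hA0))
      · rw [mul_comm (dA c)]
        exact (mul_le_mul_of_nonneg_right h'.le hA0).trans
          (le_add_of_nonneg_right (mul_nonneg hθ hB0))
  have h1 := hsumAB.trans (Finset.sum_le_sum hterm)
  rw [Finset.sum_add_distrib, ← Finset.mul_sum, Finset.sum_add_distrib, Finset.sum_ite_mem,
    Finset.inter_eq_right.2 (Finset.filter_subset _ _), Finset.sum_const, nsmul_eq_mul] at h1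
  have h2 : θ * (∑ c ∈ C, dA c + ∑ c ∈ C, dB c) ≤ θ * (m * p + m * q) := by gcongr
  linarith

/-! ### The embedding into a uniform triple. -/

/-- The product `y * z` is at least both `γ / 4` and `w / 4 * (y + z)`, so a weighted mean of the
two covers both main terms on the left with room for the uniformity errors. The term `γ / 10`
becomes the proportion of popular vertices in `C`. -/
lemma codegree_numeric {w γ y z : ℝ} (hw0 : 0 < w) (hw1 : w ≤ 1) (hwγ : w * w = γ)
    (hy : w / 2 ≤ y) (hz : w / 2 ≤ z) :
    γ / 10 + w / 10 * (y + γ / 800 + (z + γ / 800)) ≤ (y - γ / 800) * (z - γ / 800) := by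
  have hγ : 0 < γ := hwγ ▸ mul_pos hw0 hw0
  have hγw : γ ≤ w := hwγ ▸ mul_le_of_le_one_left hw0.le hw1
  have hyz : w / 2 * (w / 2) ≤ y * z := mul_le_mul hy hz (by linarith) (by linarith)
  have e1 : w / 2 * z ≤ y * z := mul_le_mul_of_nonneg_right hy (by linarith)
  have e2 : y * (w / 2) ≤ y * z := mul_le_mul_of_nonneg_left hz (by linarith)
  have e4 : (399 / 400 * y) * (399 / 400 * z) ≤ (y - γ / 800) * (z - γ / 800) :=
    mul_le_mul (by linarith) (by linarith) (by linarith) (by linarith)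
  have e5 : w * γ ≤ γ := mul_le_of_le_one_left hγ.le hw1
  nlinarith

/-- A triple of large vertex classes with `A`–`B` density at least `γ / 2` and uniform pairs at `C`
of density at least `√γ / 2` contains a large blowup of the triangle. -/
lemma IsUniform.graphBlowup_isContained {γ x y z : ℝ} {A B C : Finset V} {m n : ℕ}
    (hγ : 0 < γ) (hγ6 : γ ≤ 1) (hn : 0 < n) (hA : n ≤ A.card) (hB : n ≤ B.card) (hC : n ≤ C.card)
    (hAC : G.IsUniform (γ / 800) A C) (hBC : G.IsUniform (γ / 800) B C)
    (hx : G.edgeDensity A B = x) (hy : G.edgeDensity A C = y) (hz : G.edgeDensity B C = z)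
    (hxγ : γ / 2 ≤ x) (hyγ : √γ / 2 ≤ y) (hzγ : √γ / 2 ≤ z)
    (hm : 160 * m * 4 ^ m ≤ γ * (γ / 16) ^ m * n) :
    (graphBlowup (⊤ : SimpleGraph (Fin 3)) ⌈√γ / 10 * m⌉₊).IsContained G := by
  classical
  set w := √γ with hw
  have hw0 : 0 < w := Real.sqrt_pos.2 hγ
  have hwγ : w * w = γ := Real.mul_self_sqrt hγ.le
  have hw1 : w ≤ 1 := Real.sqrt_le_one.2 hγ6
  have hγw : γ ≤ w := by nlinarith
  have hnR : (0 : ℝ) < n := by exact_mod_cast hn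
  have hAR : (n : ℝ) ≤ A.card := by exact_mod_cast hA
  have hBR : (n : ℝ) ≤ B.card := by exact_mod_cast hB
  have hCR : (n : ℝ) ≤ C.card := by exact_mod_cast hC
  have hpow1 : (γ / 16) ^ m ≤ 1 := pow_le_one₀ (by positivity) (by linarith)
  have h4 : (1 : ℝ) ≤ 4 ^ m := one_le_pow₀ (by norm_num)
  have hm0 : (0 : ℝ) ≤ m := by positivity
  have hm1 : 160 * (m : ℝ) ≤ γ * (γ / 16) ^ m * n := by nlinarith
  have hm2 : 160 * (m : ℝ) ≤ γ * n := hm1.trans (by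
    rw [mul_right_comm]; exact mul_le_of_le_one_right (by positivity) hpow1)
  have hm3 : 160 * m * 4 ^ m ≤ γ * n := hm.trans (by
    rw [mul_right_comm]; exact mul_le_of_le_one_right (by positivity) hpow1)
  have htyp := IsUniform.card_typical_edges (by linarith) hAC hBC hx hy hz (hn.trans_le hC)
    (by linarith) (by linarith)
  have hγA : γ * n ≤ γ * A.card := by gcongr
  -- Typical edges have density at least `γ / 2 - 4 * (γ / 800)`, which exceeds `γ / 4`.
  obtain ⟨A', hA', B', hB', hA'c, hB'c, hcomp⟩ := exists_complete_of_dense _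
    (A := A) (B := B) (m := m) (ρ := γ / 4) (by positivity)
    (le_trans (by gcongr; linarith) htyp) (by linarith)
    (hn.trans_le hA) (hn.trans_le hB) (by
      have : γ * (γ / 16) ^ m * n ≤ γ * (γ / 16) ^ m * B.card := by gcongr
      rw [show γ / 4 / 4 = γ / 16 by ring]
      nlinarith)
  set t := ⌈w / 10 * m⌉₊ with ht
  have hpop := le_card_popular (θ := w / 10 * m) (by positivity) hA'c hB'c
    (p := (y + γ / 800) * C.card) (q := (z + γ / 800) * C.card)
    (d := (y - γ / 800) * (z - γ / 800) * C.card) ?_ ?_ (fun a ha b hb => (hcomp a ha b hb).2.2.2)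
  rotate_left
  -- The degree bound for `a` is part of the typicality of an edge, so a partner in `B'` is needed.
  · intro a ha
    obtain ⟨b, hb⟩ : B'.Nonempty := by
      rw [← Finset.card_pos, hB'c, ← hA'c]
      exact Finset.card_pos.2 ⟨a, ha⟩
    exact (hcomp a ha b hb).2.1
  · intro b hb
    obtain ⟨a, ha⟩ : A'.Nonempty := by
      rw [← Finset.card_pos, hA'c, ← hB'c]
      exact Finset.card_pos.2 ⟨b, hb⟩
    exact (hcomp a ha b hb).2.2.1
  set C' := C.filter fun c => w / 10 * m ≤ ((A'.filter (G.Adj c)).card : ℝ) ∧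
    w / 10 * m ≤ ((B'.filter (G.Adj c)).card : ℝ)
  have hC'card : m * m * (γ / 10 * C.card) ≤ m * m * C'.card := by
    have h3 : m * m * C.card * (γ / 10 + w / 10 * (y + γ / 800 + (z + γ / 800)))
        ≤ m * m * C.card * ((y - γ / 800) * (z - γ / 800)) :=
      mul_le_mul_of_nonneg_left (codegree_numeric hw0 hw1 hwγ hyγ hzγ) (by positivity)
    linarith
  obtain rfl | hmpos := Nat.eq_zero_or_pos m
  · exact graphBlowup_isContained_of_complete (X := ∅) (Y := ∅) (Z := ∅) (by simp [ht])
      (by simp [ht]) (by simp [ht]) (by simp) (by simp) (by simp)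
  have hmR : (0 : ℝ) < m := by exact_mod_cast hmpos
  have hC'γ : γ / 10 * C.card ≤ C'.card := le_of_mul_le_mul_left hC'card (by positivity)
  refine graphBlowup_isContained_of_traces hA'c hB'c (fun a ha b hb => (hcomp a ha b hb).1)
    (C := C') ?_ (fun c hc => Nat.ceil_le.2 (Finset.mem_filter.1 hc).2.1)
    (fun c hc => Nat.ceil_le.2 (Finset.mem_filter.1 hc).2.2)
  have htm : t ≤ m := Nat.ceil_le.2 (by nlinarith)
  have htmR : (t : ℝ) ≤ m := by exact_mod_cast htm
  have : (4 : ℝ) ^ m * t ≤ C'.card := by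
    calc (4 : ℝ) ^ m * t ≤ 4 ^ m * m := by gcongr
      _ ≤ γ * n / 160 := by linarith
      _ ≤ γ / 10 * C.card := by nlinarith
      _ ≤ _ := hC'γ
  exact_mod_cast this

end Uniform

end SimpleGraph

/-! ### Regularity and the choice of a uniform triple. -/

lemma Finpartition.sum_parts_eq {α : Type*} [DecidableEq α] {s : Finset α} (P : Finpartition s)
    (f : α → ℝ) : ∑ U ∈ P.parts, ∑ a ∈ U, f a = ∑ a ∈ s, f a := by
  conv_rhs => rw [← P.biUnion_parts]
  rw [Finset.sum_biUnion]
  · rfl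
  · exact P.disjoint

namespace SimpleGraph

section Regularity

variable {V : Type*} {G : SimpleGraph V} [DecidableRel G.Adj]

lemma triangleCount_mono {H : SimpleGraph V} [DecidableRel H.Adj] (h : H ≤ G) (A B C : Finset V) :
    H.triangleCount A B C ≤ G.triangleCount A B C := by
  refine Finset.sum_le_sum fun a _ => Finset.sum_le_sum fun b _ => Finset.sum_le_sum fun c _ => ?_
  by_cases h' : H.Adj a b ∧ H.Adj a c ∧ H.Adj b c
  · rw [if_pos h', if_pos ⟨h h'.1, h h'.2.1, h h'.2.2⟩]
  · rw [if_neg h']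
    split_ifs <;> norm_num

lemma exists_triangle_of_triangleCount_pos {A B C : Finset V} (h : 0 < G.triangleCount A B C) :
    ∃ a ∈ A, ∃ b ∈ B, ∃ c ∈ C, G.Adj a b ∧ G.Adj a c ∧ G.Adj b c := by
  by_contra! hno
  refine h.ne' (Finset.sum_eq_zero fun a ha => Finset.sum_eq_zero fun b hb =>
    Finset.sum_eq_zero fun c hc => if_neg ?_)
  rintro ⟨h1, h2, h3⟩
  exact hno a ha b hb c hc h1 h2 h3

lemma triangleCount_eq_sum_parts [DecidableEq V] {s : Finset V} (P : Finpartition s) :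
    G.triangleCount s s s
      = ∑ U ∈ P.parts, ∑ V ∈ P.parts, ∑ W ∈ P.parts, G.triangleCount U V W := by
  simp only [triangleCount]
  rw [← P.sum_parts_eq]
  refine Finset.sum_congr rfl fun U _ => ?_
  simp only [← P.sum_parts_eq]
  rw [Finset.sum_comm]
  refine Finset.sum_congr rfl fun W _ => ?_
  rw [Finset.sum_comm (s := P.parts)]
  refine Finset.sum_congr rfl fun a _ => ?_
  rw [Finset.sum_comm]

/-- A uniform triple of high triangle density contains a large blowup of the triangle. -/
lemma graphBlowup_isContained_of_uniform_triple {γ : ℝ} {A B C : Finset V} {m n : ℕ}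
    (hγ : 0 < γ) (hγ1 : γ ≤ 1) (hn : 0 < n) (hA : n ≤ A.card) (hB : n ≤ B.card) (hC : n ≤ C.card)
    (hAB : G.IsUniform (γ / 800) A B) (hAC : G.IsUniform (γ / 800) A C)
    (hBC : G.IsUniform (γ / 800) B C)
    (hT : γ / 2 * (A.card * B.card * C.card) ≤ G.triangleCount A B C)
    (hm : 160 * m * 4 ^ m ≤ γ * (γ / 16) ^ m * n) :
    (graphBlowup (⊤ : SimpleGraph (Fin 3)) ⌈√γ / 10 * m⌉₊).IsContained G := by
  have hγ800 : γ / 800 ≤ 1 := by linarith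
  have hnR : (0 : ℝ) < n := by exact_mod_cast hn
  have dens : ∀ X Y Z : Finset V, n ≤ X.card → n ≤ Y.card → n ≤ Z.card →
      γ / 2 * (X.card * Y.card * Z.card) ≤ G.triangleCount X Y Z → γ / 2 ≤ G.edgeDensity X Y := by
    intro X Y Z hX hY hZ h
    have hX' : (0 : ℝ) < X.card := by exact_mod_cast hn.trans_le hX
    have hY' : (0 : ℝ) < Y.card := by exact_mod_cast hn.trans_le hY
    have hZ' : (0 : ℝ) < Z.card := by exact_mod_cast hn.trans_le hZ
    have := h.trans (triangleCount_le_edgeDensity X Y Z)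
    have h2 : γ / 2 * (X.card * Y.card * Z.card)
        ≤ G.edgeDensity X Y * (X.card * Y.card * Z.card) := by linarith
    exact le_of_mul_le_mul_right h2 (by positivity)
  -- If both pairs at `X` were sparse, the triangle density would be at most `(√γ / 2 + γ / 800) *
  -- (√γ / 2) + γ / 800`, which is below `γ / 2`.
  have two : ∀ X Y Z : Finset V, n ≤ X.card → n ≤ Y.card → n ≤ Z.card →
      G.IsUniform (γ / 800) X Y → γ / 2 * (X.card * Y.card * Z.card) ≤ G.triangleCount X Y Z →
      (G.edgeDensity X Y : ℝ) < √γ / 2 → √γ / 2 ≤ G.edgeDensity X Z := by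
    intro X Y Z hX hY hZ hu h hlt
    by_contra! hlt'
    have hX' : (0 : ℝ) < X.card := by exact_mod_cast hn.trans_le hX
    have hY' : (0 : ℝ) < Y.card := by exact_mod_cast hn.trans_le hY
    have hZ' : (0 : ℝ) < Z.card := by exact_mod_cast hn.trans_le hZ
    have h1 := le_of_mul_le_mul_right (h.trans (hu.triangleCount_le hγ800 Z)) (by positivity)
    have hXZ : (0 : ℝ) ≤ G.edgeDensity X Z := by exact_mod_cast G.edgeDensity_nonneg X Z
    have hw : √γ * √γ = γ := Real.mul_self_sqrt hγ.le
    have hw1 : √γ ≤ 1 := Real.sqrt_le_one.2 hγ1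
    have h2 : (G.edgeDensity X Y + γ / 800) * G.edgeDensity X Z
        ≤ (√γ / 2 + γ / 800) * (√γ / 2) := by gcongr
    have h3 : γ * √γ ≤ γ := mul_le_of_le_one_right hγ.le hw1
    linarith
  have hT₁ : γ / 2 * (A.card * C.card * B.card) ≤ G.triangleCount A C B := by
    rw [← triangleCount_swap_right, mul_right_comm (A.card : ℝ)]; exact hT
  have hT₂ : γ / 2 * (B.card * A.card * C.card) ≤ G.triangleCount B A C := by
    rw [← triangleCount_swap_left, mul_comm (B.card : ℝ)]; exact hT
  have hT₃ : γ / 2 * (B.card * C.card * A.card) ≤ G.triangleCount B C A := by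
    rw [triangleCount_swap_right, mul_right_comm (B.card : ℝ)]; exact hT₂
  have hT₄ : γ / 2 * (C.card * A.card * B.card) ≤ G.triangleCount C A B := by
    rw [triangleCount_swap_left, mul_comm (C.card : ℝ)]; exact hT₁
  have hAC' := G.edgeDensity_comm A C
  have hBC' := G.edgeDensity_comm B C
  have hAB' := G.edgeDensity_comm A B
  -- The class opposite a sparse pair takes the role of `C`: both pairs at it are then dense.
  rcases lt_or_ge (G.edgeDensity A C : ℝ) (√γ / 2) with hy | hy
  · exact IsUniform.graphBlowup_isContained hγ hγ1 hn hA hC hB hAB hBC.symm rfl rfl rfl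
      (dens A C B hA hC hB hT₁) (two A C B hA hC hB hAC hT₁ hy)
      (two C A B hC hA hB hAC.symm hT₄ (by rwa [← hAC'])) hm
  rcases lt_or_ge (G.edgeDensity B C : ℝ) (√γ / 2) with hz | hz
  · exact IsUniform.graphBlowup_isContained hγ hγ1 hn hB hC hA hAB.symm hAC.symm rfl rfl rfl
      (dens B C A hB hC hA hT₃) (two B C A hB hC hA hBC hT₃ hz) (by rwa [← hAC']) hm
  · exact IsUniform.graphBlowup_isContained hγ hγ1 hn hA hB hC hAC hBC rfl rfl rfl
      (dens A B C hA hB hC hT) hy hz hm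

variable [Fintype V]

lemma sum_adj_eq_two_mul_card_edgeFinset :
    ∑ a, ∑ b, (if G.Adj a b then (1 : ℝ) else 0) = 2 * G.edgeFinset.card := by
  have h := G.two_mul_card_edgeFinset
  rw [Finset.card_filter, ← Finset.univ_product_univ, Finset.sum_product] at h
  exact_mod_cast h.symm

/-- Removing an edge destroys at most `6 |V|` ordered triangles. -/
lemma triangleCount_le_add_of_le {H : SimpleGraph V} [DecidableRel H.Adj] (h : H ≤ G) :
    G.triangleCount Finset.univ Finset.univ Finset.univ
      ≤ H.triangleCount Finset.univ Finset.univ Finset.univ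
        + 3 * Fintype.card V * (2 * (G.edgeFinset.card - H.edgeFinset.card)) := by
  set D : V → V → ℝ := fun a b => (if G.Adj a b then 1 else 0) - (if H.Adj a b then 1 else 0)
  have hD : ∑ a, ∑ b, D a b = 2 * (G.edgeFinset.card - H.edgeFinset.card) := by
    simp only [D, Finset.sum_sub_distrib, sum_adj_eq_two_mul_card_edgeFinset]
    ring
  -- A triangle that does not survive in `H` has lost one of its three edges.
  have hpt : ∀ a b c, (if G.Adj a b ∧ G.Adj a c ∧ G.Adj b c then (1 : ℝ) else 0)
      ≤ (if H.Adj a b ∧ H.Adj a c ∧ H.Adj b c then 1 else 0) + (D a b + D a c + D b c) := by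
    intro a b c
    have h1 := @h a b
    have h2 := @h a c
    have h3 := @h b c
    simp only [D]
    by_cases g1 : G.Adj a b <;> by_cases g2 : G.Adj a c <;> by_cases g3 : G.Adj b c <;>
    by_cases k1 : H.Adj a b <;> by_cases k2 : H.Adj a c <;> by_cases k3 : H.Adj b c <;>
      simp_all
  have hsum : G.triangleCount Finset.univ Finset.univ Finset.univ
      ≤ ∑ a, ∑ b, ∑ c, ((if H.Adj a b ∧ H.Adj a c ∧ H.Adj b c then (1 : ℝ) else 0)
        + (D a b + D a c + D b c)) :=
    Finset.sum_le_sum fun a _ => Finset.sum_le_sum fun b _ => Finset.sum_le_sum fun c _ =>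
      hpt a b c
  refine hsum.trans_eq ?_
  simp only [Finset.sum_add_distrib, Finset.sum_const, nsmul_eq_mul, Finset.card_univ,
    ← Finset.mul_sum, hD]
  rw [triangleCount]
  ring

/-- Szemerédi's regularity lemma supplies a uniform triple of large classes that inherits half of
the triangle density. -/
lemma exists_uniform_triple [DecidableEq V] {γ : ℝ} (hγ : 0 < γ) (hV : 0 < Fintype.card V)
    (hcard : ⌈4 / (γ / 100)⌉₊ ≤ Fintype.card V)
    (hG : γ * (Fintype.card V : ℝ) ^ 3
      ≤ G.triangleCount Finset.univ Finset.univ Finset.univ) :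
    ∃ A B C : Finset V,
      Fintype.card V / SzemerediRegularity.bound (γ / 800) ⌈4 / (γ / 100)⌉₊ ≤ A.card ∧
      Fintype.card V / SzemerediRegularity.bound (γ / 800) ⌈4 / (γ / 100)⌉₊ ≤ B.card ∧
      Fintype.card V / SzemerediRegularity.bound (γ / 800) ⌈4 / (γ / 100)⌉₊ ≤ C.card ∧
      G.IsUniform (γ / 800) A B ∧ G.IsUniform (γ / 800) A C ∧ G.IsUniform (γ / 800) B C ∧
      γ / 2 * (A.card * B.card * C.card) ≤ G.triangleCount A B C := by
  have : Nonempty V := Fintype.card_pos_iff.1 hV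
  have hVR : (0 : ℝ) < Fintype.card V := by exact_mod_cast hV
  -- With `ε = γ / 100`, the reduced graph below uses uniformity `ε / 8` and density `ε / 4`.
  rw [show γ / 800 = γ / 100 / 8 by ring]
  obtain ⟨P, hP₁, hP₂, hP₃, hP₄⟩ := szemeredi_regularity G
    (by positivity : 0 < γ / 100 / 8) hcard
  have hparts : 4 / (γ / 100) ≤ P.parts.card := (Nat.le_ceil _).trans (by exact_mod_cast hP₂)
  have hred := regularityReduced_edges_card_aux (by positivity) hP₁ hP₄ hparts
  set R := G.regularityReduced P (γ / 100 / 8) (γ / 100 / 4) with hR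
  have hcount := triangleCount_le_add_of_le (G := G) (H := R) regularityReduced_le
  -- Reduction destroys fewer than `6 * (γ / 100) * |V| ^ 3` ordered triangles, less than half of
  -- them.
  have hlow : γ / 2 * (Fintype.card V : ℝ) ^ 3
      < R.triangleCount Finset.univ Finset.univ Finset.univ := by
    have h1 := mul_lt_mul_of_pos_left hred (by positivity : 0 < 3 * (Fintype.card V : ℝ))
    push_cast at h1
    have h2 : 0 < γ * (Fintype.card V : ℝ) ^ 3 := by positivity
    nlinarith
  obtain ⟨A, hA, B, hB, C, hC, hABC⟩ : ∃ A ∈ P.parts, ∃ B ∈ P.parts, ∃ C ∈ P.parts,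
      γ / 2 * (A.card * B.card * C.card) < R.triangleCount A B C := by
    by_contra! hno
    refine hlow.not_ge ?_
    rw [triangleCount_eq_sum_parts P]
    have hs : ∑ U ∈ P.parts, (U.card : ℝ) = Fintype.card V := by
      have := P.sum_card_parts
      rw [Finset.card_univ] at this
      exact_mod_cast this
    calc _ ≤ ∑ A ∈ P.parts, ∑ B ∈ P.parts, ∑ C ∈ P.parts,
          γ / 2 * ((A.card : ℝ) * B.card * C.card) :=
          Finset.sum_le_sum fun A hA => Finset.sum_le_sum fun B hB =>
            Finset.sum_le_sum fun C hC => hno A hA B hB C hC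
      _ = _ := by
          simp only [← Finset.mul_sum, hs, ← Finset.sum_mul]
          ring
  have hsize : ∀ U ∈ P.parts,
      Fintype.card V / SzemerediRegularity.bound (γ / 100 / 8) ⌈4 / (γ / 100)⌉₊ ≤ U.card := by
    intro U hU
    have h1 := hP₁.average_le_card_part hU
    rw [Finset.card_univ] at h1
    exact (Nat.div_le_div_left hP₃ (Finset.card_pos.2 ⟨U, hU⟩)).trans h1
  -- A single triangle of the reduced graph in the triple certifies that all three pairs are
  -- uniform, as its edges only join uniform pairs.
  obtain ⟨a, ha, b, hb, c, hc, hab, hac, hbc⟩ := exists_triangle_of_triangleCount_pos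
    (lt_of_le_of_lt (by positivity) hABC)
  have huni : ∀ U ∈ P.parts, ∀ W ∈ P.parts, ∀ u ∈ U, ∀ w ∈ W, R.Adj u w →
      G.IsUniform (γ / 100 / 8) U W := by
    rintro U hU W hW u hu w hw ⟨-, U', hU', W', hW', hu', hw', -, huni, -⟩
    rwa [P.disjoint.elim hU hU' (Finset.not_disjoint_iff.2 ⟨u, hu, hu'⟩),
      P.disjoint.elim hW hW' (Finset.not_disjoint_iff.2 ⟨w, hw, hw'⟩)]
  exact ⟨A, B, C, hsize A hA, hsize B hB, hsize C hC, huni A hA B hB a ha b hb hab,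
    huni A hA C hC a ha c hc hac, huni B hB C hC b hb c hc hbc,
    hABC.le.trans (triangleCount_mono regularityReduced_le A B C)⟩

end Regularity

/-! ### Copies of the triangle against ordered triangles and vertex triples. -/

section CopyCount

variable {V : Type*} [Fintype V] {G : SimpleGraph V}

/-- The number of triangles is at most the number of `3`-subsets of the vertex set. -/
lemma copyCount_top_fin_three_le_choose :
    G.copyCount (⊤ : SimpleGraph (Fin 3)) ≤ (Fintype.card V).choose 3 := by
  classical
  rw [copyCount, ← Finset.card_univ (α := V), ← Finset.card_powersetCard]
  refine Finset.card_le_card_of_injOn (fun H => H.verts.toFinset) ?_ ?_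
  · intro H hH
    obtain ⟨e⟩ := (Finset.mem_filter.1 hH).2
    refine Finset.mem_coe.2 (Finset.mem_powersetCard.2 ⟨Finset.subset_univ _, ?_⟩)
    rw [Set.toFinset_card, ← Fintype.card_congr e.toEquiv, Fintype.card_fin]
  · intro H hH H' hH' heq
    obtain ⟨e⟩ := (Finset.mem_filter.1 hH).2
    obtain ⟨e'⟩ := (Finset.mem_filter.1 hH').2
    have hv : H.verts = H'.verts := Set.toFinset_inj.1 heq
    -- A complete subgraph is determined by its vertex set.
    have key : ∀ K : G.Subgraph, ((⊤ : SimpleGraph (Fin 3)) ≃g K.coe) → ∀ a b,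
        K.Adj a b ↔ a ∈ K.verts ∧ b ∈ K.verts ∧ a ≠ b := by
      intro K e a b
      refine ⟨fun h => ⟨K.edge_vert h, K.edge_vert h.symm, h.ne⟩, fun ⟨ha, hb, hne⟩ => ?_⟩
      have : K.coe.Adj ⟨a, ha⟩ ⟨b, hb⟩ := by
        rw [← e.symm.map_adj_iff, top_adj]
        exact fun h => hne (congrArg Subtype.val (e.symm.injective h))
      exact this
    refine Subgraph.ext hv ?_
    ext a b
    rw [key H e, key H' e', hv]

/-- The number of triangles is at most the number of ordered triangles. -/
lemma copyCount_top_fin_three_le_triangleCount [DecidableRel G.Adj] :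
    (G.copyCount (⊤ : SimpleGraph (Fin 3)) : ℝ)
      ≤ G.triangleCount Finset.univ Finset.univ Finset.univ := by
  classical
  have h1 : G.triangleCount Finset.univ Finset.univ Finset.univ
      = ((Finset.univ : Finset (V × V × V)).filter
        fun p => G.Adj p.1 p.2.1 ∧ G.Adj p.1 p.2.2 ∧ G.Adj p.2.1 p.2.2).card := by
    rw [Finset.card_filter, Fintype.sum_prod_type]
    simp only [Fintype.sum_prod_type]
    push_cast
    rfl
  rw [h1]
  set T := (Finset.univ : Finset (V × V × V)).filter
    fun p => G.Adj p.1 p.2.1 ∧ G.Adj p.1 p.2.2 ∧ G.Adj p.2.1 p.2.2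
  have hlab : G.labelledCopyCount (⊤ : SimpleGraph (Fin 3))
      = Nat.card (Copy (⊤ : SimpleGraph (Fin 3)) G) := by
    unfold labelledCopyCount
    exact Fintype.card_eq_nat_card
  have hf : ∀ f : Copy (⊤ : SimpleGraph (Fin 3)) G, ∀ i j, i ≠ j → G.Adj (f i) (f j) :=
    fun f i j h => f.toHom.map_adj ((top_adj i j).2 h)
  let F : Copy (⊤ : SimpleGraph (Fin 3)) G → T := fun f => ⟨(f 0, f 1, f 2),
    Finset.mem_filter.2 ⟨Finset.mem_univ _, hf f 0 1 (by decide), hf f 0 2 (by decide),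
      hf f 1 2 (by decide)⟩⟩
  have hF : Function.Injective F := by
    intro f g h
    have h' := congrArg Subtype.val h
    simp only [F, Prod.mk.injEq] at h'
    refine DFunLike.ext _ _ fun i => ?_
    fin_cases i
    exacts [h'.1, h'.2.1, h'.2.2]
  have h2 : G.labelledCopyCount (⊤ : SimpleGraph (Fin 3)) ≤ T.card := by
    have := Nat.card_le_card_of_injective F hF
    rwa [← hlab, Nat.card_eq_fintype_card, Fintype.card_coe] at this
  exact_mod_cast copyCount_le_labelledCopyCount.trans h2

end CopyCount

end SimpleGraph

/-! ### Choice of parameters for large `N`. -/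

/-- For large `N` there is `m` of order `log N / log (1 / γ)` for which `γ N` beats the
exponential losses of the embedding argument. -/
lemma exists_threshold_blowup_size {γ : ℝ} (hγ : 0 < γ) (hγ6 : γ < 1 / 6) {K : ℕ} (hK : 0 < K) :
    ∃ N₀ : ℕ, ∀ N : ℕ, N₀ ≤ N → 0 < N / K ∧ ∃ m : ℕ,
      160 * m * 4 ^ m ≤ γ * (γ / 16) ^ m * ((N / K : ℕ) : ℝ) ∧
      1 / 1000 * (√γ / (Real.logb 2 (1 / γ)) ^ 2) * Real.logb 2 N ≤ √γ / 10 * m := by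
  set q : ℝ := 320 * K / γ with hq
  have hKR : (1 : ℝ) ≤ K := by exact_mod_cast hK
  have hqγ : q * γ = 320 * K := by rw [hq]; field_simp
  have hq1 : 1 / γ ≤ q := by rw [hq]; gcongr; linarith
  have hγinv : 6 ≤ 1 / γ := by rw [le_div_iff₀ hγ]; linarith
  have hq0 : 1 ≤ q := by linarith
  have hqK : 2 * K ≤ q := by
    rw [hq, le_div_iff₀ hγ]; nlinarith
  refine ⟨⌈q ^ 32⌉₊, fun N hN => ?_⟩
  have hNq : q ^ 32 ≤ N := (Nat.le_ceil _).trans (by exact_mod_cast hN)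
  have hNpos : (0 : ℝ) < N := lt_of_lt_of_le (by positivity) hNq
  set s := Real.logb 2 N with hs
  set L := Real.logb 2 (1 / γ) with hL
  have hL1 : 1 ≤ L := by
    rw [hL, Real.le_logb_iff_rpow_le (by norm_num) (by positivity)]
    norm_num at hγinv ⊢
    linarith
  have hsL : 32 * L ≤ s := by
    have : ((1 / γ) ^ 32 : ℝ) ≤ N := le_trans (by gcongr) hNq
    have h := Real.logb_le_logb_of_le (b := 2) (by norm_num) (by positivity) this
    rwa [Real.logb_pow] at h
  set m := ⌊s / (16 * L)⌋₊ with hm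
  have hs0 : 0 ≤ s := by linarith
  have hmle : (m : ℝ) ≤ s / (16 * L) := Nat.floor_le (by positivity)
  have hmL : m * L ≤ s / 16 := by
    rw [le_div_iff₀ (by positivity)] at hmle
    linarith
  have hmge : s / (32 * L) ≤ m := by
    have h1 : s / (16 * L) < m + 1 := Nat.lt_floor_add_one _
    have h2 : s / (16 * L) = s / (32 * L) + s / (32 * L) := by field_simp; ring
    have h3 : 1 ≤ s / (32 * L) := by rw [le_div_iff₀ (by positivity)]; linarith
    linarith
  -- Here `u = N ^ (1 / 16)` serves as the unit: `m`, `2 ^ m` and `(1 / γ) ^ m` are at most `u`, and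
  -- so is the constant `q`, which absorbs `K` and `1 / γ`. The losses total `u ^ 6`, against `u ^
  -- 16 = N`.
  set u : ℝ := (2 : ℝ) ^ (s / 16) with hu
  have hu16 : u ^ 16 = N := by
    rw [hu, ← Real.rpow_natCast, ← Real.rpow_mul (by norm_num)]
    norm_num
    exact Real.rpow_logb (by norm_num) (by norm_num) hNpos
  have hu0 : 0 < u := by positivity
  have huq : q ≤ u := by
    refine le_of_pow_le_pow_left₀ (n := 16) (by norm_num) hu0.le ?_
    rw [hu16]
    exact (pow_le_pow_right₀ hq0 (by norm_num)).trans hNq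
  have h2m : (2 : ℝ) ^ m ≤ u := by
    rw [hu, ← Real.rpow_natCast]
    exact Real.rpow_le_rpow_of_exponent_le (by norm_num) (by nlinarith)
  have hγm : (1 / γ) ^ m ≤ u := by
    have h : (2 : ℝ) ^ L = 1 / γ := Real.rpow_logb (by norm_num) (by norm_num) (by positivity)
    rw [← h, ← Real.rpow_natCast, ← Real.rpow_mul (by norm_num), hu]
    exact Real.rpow_le_rpow_of_exponent_le (by norm_num) (by linarith)
  have hmu : (m : ℝ) ≤ u := le_trans (by exact_mod_cast (Nat.lt_two_pow_self).le) h2m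
  have h4m : (4 : ℝ) ^ m ≤ u ^ 2 := by
    rw [show (4 : ℝ) = 2 ^ 2 by norm_num, ← pow_mul, mul_comm, pow_mul]
    gcongr
  have hγ16 : 1 ≤ (γ / 16) ^ m * u ^ 3 := by
    -- This holds because `γ < 1 / 6` gives `γ ^ 2 < 1 / 16`; it turns the base `γ / 16` into a
    -- power of `γ`.
    have h1 : γ ^ 3 ≤ γ / 16 := by nlinarith [mul_pos hγ hγ]
    calc (1 : ℝ) = (γ ^ 3) ^ m * ((1 / γ) ^ m) ^ 3 := by
          rw [← pow_mul, ← pow_mul, mul_comm m 3, ← mul_pow, mul_one_div_cancel hγ.ne', one_pow]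
      _ ≤ _ := by gcongr
  have hNK : (N : ℝ) ≤ 2 * K * ((N / K : ℕ) : ℝ) := by
    have h1 : N < K * (N / K + 1) := Nat.lt_mul_div_succ N hK
    have h1' : (N : ℝ) ≤ K * (((N / K : ℕ) : ℝ) + 1) := by exact_mod_cast h1.le
    have h2 : 2 * (K : ℝ) ≤ N := hqK.trans ((le_self_pow₀ hq0 (by norm_num)).trans hNq)
    linarith
  have hn0 : 0 < ((N / K : ℕ) : ℝ) := by
    by_contra! h
    have : 2 * K * ((N / K : ℕ) : ℝ) ≤ 0 := mul_nonpos_of_nonneg_of_nonpos (by positivity) h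
    linarith
  refine ⟨by exact_mod_cast hn0, m, ?_, ?_⟩
  · set n : ℝ := ((N / K : ℕ) : ℝ)
    have hu1 : 1 ≤ u := hq0.trans huq
    have h1 : 160 * u ^ 6 ≤ γ * n := by
      have h2 : 320 * K * u ^ 6 ≤ γ * u ^ 16 := by
        rw [← hqγ]
        calc q * γ * u ^ 6 ≤ u * γ * u ^ 6 := by gcongr
          _ = γ * u ^ 7 := by ring
          _ ≤ γ * u ^ 16 := by gcongr; norm_num
      rw [hu16] at h2
      have h3 : γ * N ≤ γ * (2 * K * n) := by gcongr
      have h4 : 2 * K * (160 * u ^ 6) ≤ 2 * K * (γ * n) := by linarith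
      exact le_of_mul_le_mul_left h4 (by positivity)
    have h5 : (160 * m * 4 ^ m) * u ^ 3 ≤ (γ * (γ / 16) ^ m * n) * u ^ 3 := by
      calc (160 * m * 4 ^ m) * u ^ 3 ≤ (160 * u * u ^ 2) * u ^ 3 := by gcongr
        _ = 160 * u ^ 6 * 1 := by ring
        _ ≤ γ * n * ((γ / 16) ^ m * u ^ 3) := by gcongr
        _ = _ := by ring
    exact le_of_mul_le_mul_right h5 (by positivity)
  · have hw : 0 ≤ √γ := Real.sqrt_nonneg γ
    calc 1 / 1000 * (√γ / L ^ 2) * s = √γ / 1000 * (s / (L * L)) := by ring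
      -- One factor `L ≥ 1` is given away here.
      _ ≤ √γ / 1000 * (s / (1 * L)) := by gcongr
      _ = √γ * 32 / 1000 * (s / (32 * L)) := by field_simp
      _ ≤ √γ * 32 / 1000 * m := by gcongr
      _ ≤ √γ * (1 / 10) * m := by
        rw [mul_div_assoc]
        exact mul_le_mul_of_nonneg_right (mul_le_mul_of_nonneg_left (by norm_num) hw)
          (Nat.cast_nonneg m)
      _ = _ := by ring

/-! ### Admissible constants and the theorem. -/

lemma graphBlowup_zero_isContained {W V : Type*} (H : SimpleGraph W) (G : SimpleGraph V) :
    (graphBlowup H 0).IsContained G :=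
  ⟨⟨⟨fun p => p.2.elim0, fun {p} => p.2.elim0⟩, fun p => p.2.elim0⟩⟩

/-- For `γ ≥ 1 / 6` every constant is admissible for the triangle. -/
lemma isBlowupConstant_triangle_of_ge {γ : ℝ} (hγ : 1 / 6 ≤ γ) (c : ℝ) :
    IsBlowupConstant (⊤ : SimpleGraph (Fin 3)) γ c := by
  refine ⟨0, tendsto_const_nhds, fun N G hG => ⟨0, ?_, graphBlowup_zero_isContained _ _⟩⟩
  -- The empty graph meets the copy bound, but there the logarithm is `0`. For `N ≥ 1` the bound
  -- fails, since `N.choose 3` is below `N ^ 3 / 6`.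
  obtain rfl | hN := Nat.eq_zero_or_pos N
  · simp
  exfalso
  have h1 : (G.copyCount (⊤ : SimpleGraph (Fin 3)) : ℝ) ≤ (N.choose 3 : ℝ) := by
    have := G.copyCount_top_fin_three_le_choose
    rw [Fintype.card_fin] at this
    exact_mod_cast this
  have h2 : (6 : ℝ) * N.choose 3 < (N : ℝ) ^ 3 := by
    have h := Nat.descFactorial_eq_factorial_mul_choose N 3
    have h3 : N.descFactorial 3 < N ^ 3 := Nat.descFactorial_lt_pow hN.ne' (by norm_num)
    rw [h] at h3
    exact_mod_cast h3
  rw [Fintype.card_fin] at hG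
  have h3 : 1 / 6 * (N : ℝ) ^ 3 ≤ γ * (N : ℝ) ^ 3 := by gcongr
  linarith

/-- For `γ < 1 / 6` the constant `√γ / (1000 log² (1 / γ))` is admissible for the triangle. -/
lemma isBlowupConstant_triangle_of_lt {γ : ℝ} (hγ : 0 < γ) (hγ6 : γ < 1 / 6) :
    IsBlowupConstant (⊤ : SimpleGraph (Fin 3)) γ
      (1 / 1000 * (√γ / (Real.logb 2 (1 / γ)) ^ 2)) := by
  classical
  set c := 1 / 1000 * (√γ / (Real.logb 2 (1 / γ)) ^ 2) with hc
  set l := ⌈4 / (γ / 100)⌉₊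
  obtain ⟨N₀, hN₀⟩ := exists_threshold_blowup_size hγ hγ6
    (SzemerediRegularity.bound_pos (ε := γ / 800) (l := l))
  set N₁ := max (max N₀ l) 1
  -- Below the threshold the error term cancels `c`, so the empty blowup suffices.
  refine ⟨fun N => if N₁ ≤ N then 0 else c, ?_, fun N G hG => ?_⟩
  · refine tendsto_const_nhds.congr' ?_
    filter_upwards [eventually_ge_atTop N₁] with N hN
    rw [if_pos hN]
  by_cases hN : N₁ ≤ N
  · obtain ⟨hn, m, hm, hcm⟩ := hN₀ N (le_trans (by simp [N₁]) hN)
    have hl : l ≤ N := le_trans (by simp [N₁]) hN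
    have hN1 : 1 ≤ N := le_trans (by simp [N₁]) hN
    rw [Fintype.card_fin] at hG
    obtain ⟨A, B, C, hA, hB, hC, hAB, hAC, hBC, hT⟩ := G.exists_uniform_triple hγ
      (by rwa [Fintype.card_fin]) (by rwa [Fintype.card_fin])
      (by rw [Fintype.card_fin]; exact hG.trans G.copyCount_top_fin_three_le_triangleCount)
    rw [Fintype.card_fin] at hA hB hC
    refine ⟨⌈√γ / 10 * m⌉₊, ?_, SimpleGraph.graphBlowup_isContained_of_uniform_triple hγ
      (by linarith) hn hA hB hC hAB hAC hBC hT hm⟩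
    simp only [if_pos hN, sub_zero]
    exact hcm.trans (Nat.le_ceil _)
  · exact ⟨0, by simp [if_neg hN], graphBlowup_zero_isContained _ _⟩

theorem theorem5p2 :
    ∃ δ : ℝ, 0 < δ ∧ ∀ γ : ℝ, 0 < γ → γ < 1 →
      ENNReal.ofReal (δ * (Real.sqrt γ / (Real.logb 2 (1 / γ)) ^ 2)) ≤
        nikiforovConstant (⊤ : SimpleGraph (Fin 3)) γ := by
  refine ⟨1 / 1000, by norm_num, fun γ hγ hγ1 => le_sSup ⟨_, ⟨?_, ?_⟩, rfl⟩⟩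
  · have hL : 0 < Real.logb 2 (1 / γ) :=
      Real.logb_pos (by norm_num) (by rw [lt_div_iff₀ hγ]; linarith)
    have := Real.sqrt_pos.2 hγ
    positivity
  · rcases lt_or_ge γ (1 / 6) with h | h
    · exact isBlowupConstant_triangle_of_lt hγ h
    · exact isBlowupConstant_triangle_of_ge h _
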